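/- Let $\mathfrak g$ be a real Lie algebra of dimension $5$. For $\eta\in\mathfrak g^*$ put $d\eta(X,Y)=-\eta([X,Y])$, and for a complex-valued alternating $2$-form $\epsilon$ on $\mathfrak g$ put $d\epsilon(X,Y,Z)=-\epsilon([X,Y],Z)+\epsilon([X,Z],Y)-\epsilon([Y,Z],X)$. A *contact Calabi–Yau structure* on $\mathfrak g$ is a triple $(\eta,J,\epsilon)$ such that: 1. $(\eta,J)$ is a Sasakian structure: $\eta\in\mathfrak g^*$ is a contact form, i.e. $\eta\wedge(d\eta)^2\neq0$, and $J$ is a linear endomorphism of $\mathfrak g$ such that, $\xi$ denoting the Reeb vector of $\eta$ (determined by $\eta(\xi)=1$ and $d\eta(\xi,\cdot)=0$), one has $J^2=-\mathrm{Id}+\eta\otimes\xi$, the bilinear form $\tfrac12 d\eta(X,JY)+\eta(X)\eta(Y)$ is symmetric and positive definite, and $$J^2[X,Y]+[JX,JY]-J[JX,Y]-J[X,JY]+d\eta(X,Y)\,\xi=0\qquad\text{for all }X,Y\in\mathfrak g;$$ 2. $\epsilon$ is a nonzero complex-valued alternating $2$-form on $\mathfrak g$ that is basic ($\epsilon(\xi,\cdot)=0$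 and $d\epsilon(\xi,\cdot,\cdot)=0$) and of type $(2,0)$ on $\ker\eta$ with respect to $J$ ($\epsilon(JX,Y)=i\,\epsilon(X,Y)$ for $X,Y\in\ker\eta$), and that satisfies $$d\epsilon=0,\qquad \epsilon\wedge\bar\epsilon=(-1)^{\frac{n(n+1)}2}\,i^n\,(d\eta)^n\quad\text{with } n=2,\qquad\text{i.e. }\ \epsilon\wedge\bar\epsilon=(d\eta)^2 .$$ Let $\mathfrak h_1$ be the real Lie algebra with basis $X_1,\dots,X_5$ whose nonzero brackets are $[X_1,X_4]=[X_2,X_3]=X_5$ (and those following by antisymmetry); it is nilpotent. If $[\mathfrak g,\mathfrak g]\neq\mathfrak g$ and $\mathfrak g$ admits a contact Calabi–Yau structure, then $\mathfrak g$ is isomorphic to the nilpotent Lie algebra $\mathfrak h_1$. In particular, if $\mathfrak g$ is solvable and not nilpotent, then $\mathfrak g$ admits no contact Calabi–Yau structure. -/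

import Mathlib

namespace ContactCY

section Forms

variable {g : Type*} [LieRing g] [LieAlgebra ℝ g]

/-- The differential of a left-invariant 1-form `η`: `(dη)(X, Y) = -η([X, Y])`. -/
def d₁ (η : Module.Dual ℝ g) (X Y : g) : ℝ := -η ⁅X, Y⁆

/-- The differential of a left-invariant complex-valued 2-form `ε`:
`(dε)(X, Y, Z) = -ε([X, Y], Z) + ε([X, Z], Y) - ε([Y, Z], X)`. -/
noncomputable def d₂ (ε : g →ₗ[ℝ] g →ₗ[ℝ] ℂ) (X Y Z : g) : ℂ :=
  -ε ⁅X, Y⁆ Z + ε ⁅X, Z⁆ Y - ε ⁅Y, Z⁆ X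

/-- The wedge product of two 2-forms (with real or complex values), evaluated on four vectors:
the signed sum over the six (2,2)-shuffles. -/
def wedge₂₂ {V R : Type*} [Ring R] (α β : V → V → R) (X Y Z W : V) : R :=
  α X Y * β Z W - α X Z * β Y W + α X W * β Y Z
    + α Y Z * β X W - α Y W * β X Z + α Z W * β X Y

/-- The wedge product of a 1-form and a 4-form, evaluated on five vectors:
the signed sum over the five (1,4)-shuffles. -/
def wedge₁₄ {V R : Type*} [Ring R] (α : V → R) (φ : V → V → V → V → R) (X Y Z W U : V) : R :=
  α X * φ Y Z W U - α Y * φ X Z W U + α Z * φ X Y W U - α W * φ X Y Z U + α U * φ X Y Z W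

/-- `η` is a contact form on a 5-dimensional Lie algebra: `η ∧ (dη)² ≠ 0`. -/
def IsContactForm (η : Module.Dual ℝ g) : Prop :=
  ∃ X Y Z W U : g, wedge₁₄ η (wedge₂₂ (d₁ η) (d₁ η)) X Y Z W U ≠ 0

/-- `ξ` is the Reeb vector of `η`: `η(ξ) = 1` and `i_ξ dη = 0`. For a contact form `η` on a
5-dimensional Lie algebra it exists and is unique. -/
structure IsReebVector (η : Module.Dual ℝ g) (ξ : g) : Prop where
  eta_xi : η ξ = 1
  d_eta_xi : ∀ X : g, d₁ η ξ X = 0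

/-- The bilinear form `g(X, Y) = ½ dη(X, JY) + η(X) η(Y)` induced by `(η, J)`. -/
noncomputable def inducedMetric (η : Module.Dual ℝ g) (J : Module.End ℝ g) (X Y : g) : ℝ :=
  (1 / 2) * d₁ η X (J Y) + η X * η Y

/-- The Nijenhuis tensor of an endomorphism `J`:
`N_J(X, Y) = J²[X, Y] + [JX, JY] - J[JX, Y] - J[X, JY]`. -/
def nijenhuis (J : Module.End ℝ g) (X Y : g) : g :=
  J (J ⁅X, Y⁆) + ⁅J X, J Y⁆ - J ⁅J X, Y⁆ - J ⁅X, J Y⁆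

/-- `(η, J)`, with Reeb vector `ξ`, is a (left-invariant) Sasakian structure on a 5-dimensional
Lie algebra: a contact metric structure that is normal. Here `dη` carries no factor `1/2`, so
that normality reads `N_J + dη ⊗ ξ = 0`. -/
structure IsSasakian (η : Module.Dual ℝ g) (ξ : g) (J : Module.End ℝ g) : Prop where
  contact : IsContactForm η
  reeb : IsReebVector η ξ
  J_sq : ∀ X : g, J (J X) = -X + η X • ξ
  metric_symm : ∀ X Y : g, inducedMetric η J X Y = inducedMetric η J Y X
  metric_pos : ∀ X : g, X ≠ 0 → 0 < inducedMetric η J X X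
  normal : ∀ X Y : g, nijenhuis J X Y + d₁ η X Y • ξ = 0

end Forms

/-- A (left-invariant) contact Calabi–Yau structure `(η, J, ε)` on a 5-dimensional Lie algebra.
The Reeb vector `ξ`, which `η` determines, is recorded too. The form `ε` on `ker η` is extended
to the whole Lie algebra by `i_ξ ε = 0`. -/
structure ContactCalabiYau (g : Type*) [LieRing g] [LieAlgebra ℝ g] where
  η : Module.Dual ℝ g
  ξ : g
  J : Module.End ℝ g
  ε : g →ₗ[ℝ] g →ₗ[ℝ] ℂ
  sasakian : IsSasakian η ξ J
  /-- `ε` is a 2-form. -/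
  alternating : ∀ X : g, ε X X = 0
  /-- `ε` is of type (2,0) with respect to `J` on `ker η`. -/
  type_two_zero : ∀ X Y : g, η X = 0 → η Y = 0 → ε (J X) Y = Complex.I * ε X Y
  /-- `ε` is basic: `i_ξ ε = 0` ... -/
  basic : ∀ X : g, ε ξ X = 0
  /-- ... and `i_ξ dε = 0`. -/
  basic_d : ∀ X Y : g, d₂ ε ξ X Y = 0
  /-- `ε` is nowhere vanishing. -/
  ne_zero : ε ≠ 0
  /-- `dε = 0`. -/
  closed : ∀ X Y Z : g, d₂ ε X Y Z = 0
  /-- `ε ∧ ε̄ = (-1)^(n(n+1)/2) iⁿ (dη)ⁿ` for `n = 2`. -/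
  volume_eq : ∀ X Y Z W : g,
    wedge₂₂ (fun A B => ε A B) (fun A B => (starRingEnd ℂ) (ε A B)) X Y Z W =
      (-1) ^ 3 * Complex.I ^ 2 * ((wedge₂₂ (d₁ η) (d₁ η) X Y Z W : ℝ) : ℂ)

/-- The Lie algebra `𝔥₁`: the vector space `ℝ⁵` with basis `X₁, …, X₅` (the `k`-th coordinate
being indexed by `k - 1 : Fin 5`), whose nonzero brackets of basis vectors are
`[X₁, X₄] = [X₂, X₃] = X₅` and those obtained from them by antisymmetry. -/
def H1 : Type := Fin 5 → ℝ

namespace H1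

noncomputable instance : AddCommGroup H1 := inferInstanceAs (AddCommGroup (Fin 5 → ℝ))

noncomputable instance : Module ℝ H1 := inferInstanceAs (Module ℝ (Fin 5 → ℝ))

noncomputable instance : Bracket H1 H1 where
  bracket x y := fun k : Fin 5 =>
    if k = 4 then (x 0 * y 3 - x 3 * y 0) + (x 1 * y 2 - x 2 * y 1) else 0

theorem bracket_apply (x y : H1) (k : Fin 5) :
    ⁅x, y⁆ k = if k = 4 then (x 0 * y 3 - x 3 * y 0) + (x 1 * y 2 - x 2 * y 1) else 0 := rfl

theorem add_apply (x y : H1) (k : Fin 5) : (x + y) k = x k + y k := rfl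

theorem smul_apply (t : ℝ) (x : H1) (k : Fin 5) : (t • x) k = t * x k := rfl

theorem zero_apply (k : Fin 5) : (0 : H1) k = 0 := rfl

noncomputable instance : LieRing H1 where
  add_lie x y z := by
    funext k; simp only [add_apply, bracket_apply]; split_ifs <;> ring
  lie_add x y z := by
    funext k; simp only [add_apply, bracket_apply]; split_ifs <;> ring
  lie_self x := by
    funext k; simp only [zero_apply, bracket_apply]; split_ifs <;> ring
  leibniz_lie x y z := by
    funext k
    simp only [add_apply, bracket_apply]
    split_ifs <;> simp_all

noncomputable instance : LieAlgebra ℝ H1 where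
  lie_smul t x y := by
    funext k; simp only [smul_apply, bracket_apply]; split_ifs <;> ring

end H1

end ContactCY

/-! The idea is that the transverse geometry of `ξ` is Kähler with a closed (2,0)-form of constant
norm, so its holonomy algebra lies in 𝔰𝔲(2). Since `ad ξ` preserves `J`, `dη` and `ε`, it acts on
`ker η` through 𝔰𝔲(2), the imaginary quaternions, whose nonzero elements are invertible. Hence `ad ξ
≠ 0` makes the algebra perfect (`lie_reeb_eq_zero`). Otherwise `ξ` is central. Closedness of `dη`
and `ε` then gives a torsion-free 𝔰𝔲(2)-connection θ on `ker η` (`exists_connection`). The Jacobi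
identity contracted with the volume form reads `∑ |θ(eᵢ)|² = 0` (`lie_eq`), so θ = 0 and the only
brackets left are those forced by `dη`, which are those of 𝔥₁. -/

namespace ContactCY

/-! ### Adapted orthonormal frames -/

section Frame

variable {g : Type*} [LieRing g] [LieAlgebra ℝ g]

/-- A basis `e₀, e₁ = J e₀, e₂, e₃ = J e₂, ξ` that is orthonormal for the induced metric; the
`(2,0)`-form is then `c (e⁰ + i e¹) ∧ (e² + i e³)`. -/
structure IsAdaptedFrame (C : ContactCalabiYau g) (e : Module.Basis (Fin 5) ℝ g) (c : ℂ) : Prop where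
  reeb : e 4 = C.ξ
  J0 : C.J (e 0) = e 1
  J1 : C.J (e 1) = -e 0
  J2 : C.J (e 2) = e 3
  J3 : C.J (e 3) = -e 2
  eta0 : C.η (e 0) = 0
  eta1 : C.η (e 1) = 0
  eta2 : C.η (e 2) = 0
  eta3 : C.η (e 3) = 0
  eta4 : C.η (e 4) = 1
  eta01 : C.η ⁅e 0, e 1⁆ = -2
  eta02 : C.η ⁅e 0, e 2⁆ = 0
  eta03 : C.η ⁅e 0, e 3⁆ = 0
  eta12 : C.η ⁅e 1, e 2⁆ = 0
  eta13 : C.η ⁅e 1, e 3⁆ = 0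
  eta23 : C.η ⁅e 2, e 3⁆ = -2
  c_ne : c ≠ 0
  eps01 : C.ε (e 0) (e 1) = 0
  eps02 : C.ε (e 0) (e 2) = c
  eps03 : C.ε (e 0) (e 3) = Complex.I * c
  eps12 : C.ε (e 1) (e 2) = Complex.I * c
  eps13 : C.ε (e 1) (e 3) = -c
  eps23 : C.ε (e 2) (e 3) = 0

namespace ContactCalabiYau

variable (C : ContactCalabiYau g)

theorem J_reeb : C.J C.ξ = 0 := by
  have h := C.sasakian.J_sq C.ξ
  rw [C.sasakian.reeb.eta_xi, one_smul, neg_add_cancel] at h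
  have h2 := C.sasakian.J_sq (C.J C.ξ)
  rw [h, map_zero] at h2
  have h3 : C.J C.ξ = C.η (C.J C.ξ) • C.ξ := by
    rw [eq_comm, neg_add_eq_zero] at h2; exact h2
  have h4 : C.η (C.J C.ξ) • C.J C.ξ = 0 := by
    rw [← map_smul, ← h3, h]
  rcases smul_eq_zero.1 h4 with h5 | h5
  · rw [h3, h5, zero_smul]
  · exact h5

theorem reeb_ne_zero : C.ξ ≠ 0 := by
  intro h
  have := C.sasakian.reeb.eta_xi
  simp [h] at this

/-- Compare `J(J²X)` with `J²(JX)`: they differ by `η(JX) ξ`. -/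
theorem eta_J (X : g) : C.η (C.J X) = 0 := by
  have h := C.sasakian.J_sq (C.J X)
  rw [C.sasakian.J_sq X, map_add, map_neg, map_smul, C.J_reeb, smul_zero, add_zero,
    left_eq_add] at h
  exact (smul_eq_zero.1 h).resolve_right C.reeb_ne_zero

theorem J_J {X : g} (hX : C.η X = 0) : C.J (C.J X) = -X := by
  rw [C.sasakian.J_sq, hX, zero_smul, add_zero]

theorem eta_lie_J_symm (X Y : g) : C.η ⁅X, C.J Y⁆ = C.η ⁅Y, C.J X⁆ := by
  have := C.sasakian.metric_symm X Y
  simp only [inducedMetric, d₁] at this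
  linarith

theorem eta_lie_J_neg {X : g} (hX : C.η X = 0) (h0 : X ≠ 0) : C.η ⁅X, C.J X⁆ < 0 := by
  have := C.sasakian.metric_pos X h0
  simp only [inducedMetric, d₁, hX] at this
  linarith

theorem eta_lie_reeb (X : g) : C.η ⁅C.ξ, X⁆ = 0 := by
  have := C.sasakian.reeb.d_eta_xi X
  simpa [d₁] using this

theorem eps_swap (X Y : g) : C.ε X Y = -C.ε Y X := by
  have := C.alternating (X + Y)
  simp only [map_add, LinearMap.add_apply, C.alternating, zero_add, add_zero] at this
  exact eq_neg_of_add_eq_zero_right this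

/-- `ad ξ` commutes with `J`. -/
theorem lie_reeb_J (X : g) : ⁅C.ξ, C.J X⁆ = C.J ⁅C.ξ, X⁆ := by
  -- As `Jξ = 0` and `[ξ, X] ∈ ker η`, normality at `(ξ, X)` reads `-[ξ, X] = J[ξ, JX]`; applying
  -- `J` once more gives the claim.
  have h := C.sasakian.normal C.ξ X
  rw [nijenhuis, C.J_reeb, C.sasakian.reeb.d_eta_xi, zero_smul, zero_lie, zero_lie, map_zero,
    add_zero, add_zero, sub_zero, C.J_J (C.eta_lie_reeb X)] at h
  have h2 := C.J_J (C.eta_lie_reeb (C.J X))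
  have h3 : C.J ⁅C.ξ, C.J X⁆ = -⁅C.ξ, X⁆ := (sub_eq_zero.1 h).symm
  rw [h3, map_neg] at h2
  exact (neg_injective h2).symm

/-- A vector of `ker η` of unit length for the induced metric, orthogonal to a given vector of
`ker η` and to its image under `J`. -/
theorem exists_unit_orthogonal (hdim : Module.finrank ℝ g = 5) (Z : g) :
    ∃ X : g, C.η X = 0 ∧ C.η ⁅X, C.J X⁆ = -2 ∧ C.η ⁅Z, X⁆ = 0 ∧ C.η ⁅C.J Z, X⁆ = 0 := by
  have : FiniteDimensional ℝ g := Module.finite_of_finrank_pos (by omega)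
  let f : g →ₗ[ℝ] (Fin 3 → ℝ) := LinearMap.pi ![C.η, C.η ∘ₗ (LieAlgebra.ad ℝ g Z : g →ₗ[ℝ] g),
    C.η ∘ₗ (LieAlgebra.ad ℝ g (C.J Z) : g →ₗ[ℝ] g)]
  -- Three linear conditions on a space of dimension 5.
  have hf : LinearMap.ker f ≠ ⊥ := LinearMap.ker_ne_bot_of_finrank_lt (by simp [hdim])
  obtain ⟨X, hX, h0⟩ := (Submodule.ne_bot_iff _).1 hf
  rw [LinearMap.mem_ker] at hX
  have k0 : C.η X = 0 := congrFun hX 0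
  have k1 : C.η ⁅Z, X⁆ = 0 := congrFun hX 1
  have k2 : C.η ⁅C.J Z, X⁆ = 0 := congrFun hX 2
  have hneg := C.eta_lie_J_neg k0 h0
  set q := C.η ⁅X, C.J X⁆ with hq
  have hs : Real.sqrt (-2 / q) * Real.sqrt (-2 / q) = -2 / q :=
    Real.mul_self_sqrt (div_nonneg_of_nonpos (by norm_num) hneg.le)
  refine ⟨Real.sqrt (-2 / q) • X, ?_, ?_, ?_, ?_⟩
  · simp [k0]
  · rw [map_smul, smul_lie, lie_smul, map_smul, map_smul, smul_smul, hs, ← hq, smul_eq_mul]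
    field_simp [hneg.ne]
  · simp [k1]
  · simp [k2]

theorem exists_adaptedFrame (hdim : Module.finrank ℝ g = 5) :
    ∃ e c, IsAdaptedFrame C e c := by
  -- With `Z = 0` the orthogonality conditions are vacuous.
  obtain ⟨u, hu, huu, -, -⟩ := C.exists_unit_orthogonal hdim 0
  obtain ⟨v, hv, hvv, huv, hJuv⟩ := C.exists_unit_orthogonal hdim u
  have huJv : C.η ⁅u, C.J v⁆ = 0 := by
    rw [C.eta_lie_J_symm, ← lie_skew, map_neg, hJuv, neg_zero]
  have hJuJv : C.η ⁅C.J u, C.J v⁆ = 0 := by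
    rw [C.eta_lie_J_symm, C.J_J hu, lie_neg, map_neg, ← lie_skew, map_neg, huv]; simp
  have skew : ∀ {X Y : g} {r : ℝ}, C.η ⁅X, Y⁆ = r → C.η ⁅Y, X⁆ = -r := by
    intro X Y r h; rw [← lie_skew, map_neg, h]
  have hli : LinearIndependent ℝ ![u, C.J u, v, C.J v, C.ξ] := by
    rw [Fintype.linearIndependent_iff]
    intro a ha
    simp only [Fin.sum_univ_five, Matrix.cons_val] at ha
    have key : ∀ f : g →ₗ[ℝ] ℝ, a 0 * f u + a 1 * f (C.J u) + a 2 * f v + a 3 * f (C.J v)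
        + a 4 * f C.ξ = 0 := by
      intro f
      have := congrArg f ha
      simpa using this
    -- In this frame `dη` pairs each of `u, Ju, v, Jv` only with its partner under `J`, so four
    -- choices of `W` isolate the first four coefficients.
    have kη : ∀ W : g, a 0 * C.η ⁅W, u⁆ + a 1 * C.η ⁅W, C.J u⁆ + a 2 * C.η ⁅W, v⁆
        + a 3 * C.η ⁅W, C.J v⁆ + a 4 * C.η ⁅W, C.ξ⁆ = 0 := fun W =>
      key (C.η ∘ₗ (LieAlgebra.ad ℝ g W : g →ₗ[ℝ] g))
    have e4 := key C.η
    have e0 := kη (C.J u)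
    have e1 := kη u
    have e2 := kη (C.J v)
    have e3 := kη v
    simp only [hu, hv, C.eta_J, C.sasakian.reeb.eta_xi, huu, hvv, huv, hJuv, huJv, hJuJv,
      skew huu, skew hvv, skew huv, skew hJuv, skew huJv, skew hJuJv, lie_self, map_zero,
      skew (C.eta_lie_reeb _)] at e0 e1 e2 e3 e4
    intro i
    fin_cases i
    · show a 0 = 0
      linarith
    · show a 1 = 0
      linarith
    · show a 2 = 0
      linarith
    · show a 3 = 0
      linarith
    · show a 4 = 0
      linarith
  let e : Module.Basis (Fin 5) ℝ g := basisOfLinearIndependentOfCardEqFinrank hli (by simp [hdim])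
  have he : ⇑e = ![u, C.J u, v, C.J v, C.ξ] := coe_basisOfLinearIndependentOfCardEqFinrank _ _
  have t := C.type_two_zero
  have e01 : C.ε u (C.J u) = 0 := by rw [C.eps_swap, t u u hu hu, C.alternating]; simp
  have e23 : C.ε v (C.J v) = 0 := by rw [C.eps_swap, t v v hv hv, C.alternating]; simp
  have e03 : C.ε u (C.J v) = Complex.I * C.ε u v := by
    rw [C.eps_swap, t v u hv hu, C.eps_swap v u]; ring
  have e12 : C.ε (C.J u) v = Complex.I * C.ε u v := t u v hu hv
  have e13 : C.ε (C.J u) (C.J v) = -C.ε u v := by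
    rw [t u _ hu (C.eta_J v), e03, ← mul_assoc, Complex.I_mul_I]; ring
  refine ⟨e, C.ε u v, ?_⟩
  constructor <;> try simp only [he, Matrix.cons_val]
  all_goals first
    | assumption
    | exact C.J_J hu
    | exact C.J_J hv
    | exact C.eta_J _
    | exact C.sasakian.reeb.eta_xi
    | skip
  -- What remains is `c ≠ 0`: by type (2,0) and basicness, `ε` is determined by `ε u v`.
  intro h0
  apply C.ne_zero
  refine e.ext fun i => e.ext fun j => ?_
  have hξ : ∀ X, C.ε X C.ξ = 0 := fun X => by rw [C.eps_swap, C.basic, neg_zero]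
  fin_cases i <;> fin_cases j <;>
    simp [he, C.alternating, C.basic, hξ, e01, e23, e03, e12, e13, h0, C.eps_swap (C.J u) u,
      C.eps_swap v u, C.eps_swap v (C.J u), C.eps_swap (C.J v) u, C.eps_swap (C.J v) (C.J u),
      C.eps_swap (C.J v) v]

end ContactCalabiYau

end Frame

end ContactCY

namespace ContactCY

/-! ### The Reeb vector is central unless the algebra is perfect -/

section Central

variable {g : Type*} [LieRing g] [LieAlgebra ℝ g]

theorem mem_derived (X Y : g) : ⁅X, Y⁆ ∈ (⁅(⊤ : LieIdeal ℝ g), (⊤ : LieIdeal ℝ g)⁆ : LieIdeal ℝ g) :=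
  LieSubmodule.lie_mem_lie (LieSubmodule.mem_top _) (LieSubmodule.mem_top _)

namespace IsAdaptedFrame

variable {C : ContactCalabiYau g} {e : Module.Basis (Fin 5) ℝ g} {c : ℂ}

theorem exists_coords (F : IsAdaptedFrame C e c) (X : g) :
    ∃ p q r s : ℝ, X = p • e 0 + q • e 1 + r • e 2 + s • e 3 + C.η X • e 4 := by
  refine ⟨e.repr X 0, e.repr X 1, e.repr X 2, e.repr X 3, ?_⟩
  have h : X = e.repr X 0 • e 0 + e.repr X 1 • e 1 + e.repr X 2 • e 2 + e.repr X 3 • e 3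
      + e.repr X 4 • e 4 := by
    conv_lhs => rw [← e.sum_repr X, Fin.sum_univ_five]
  have h2 := congrArg C.η h
  simp only [map_add, map_smul, F.eta0, F.eta1, F.eta2, F.eta3, F.eta4, smul_eq_mul, mul_zero,
    mul_one, zero_add] at h2
  rw [h2]
  exact h

theorem eps_reeb_left (F : IsAdaptedFrame C e c) (X : g) : C.ε (e 4) X = 0 := by
  rw [F.reeb, C.basic]

theorem eq_zero_of_mul_eq_zero (F : IsAdaptedFrame C e c) {p q : ℝ}
    (h : ((p : ℂ) + q * Complex.I) * c = 0) : p = 0 ∧ q = 0 := by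
  have h := (mul_eq_zero.1 h).resolve_right F.c_ne
  have h1 := congrArg Complex.re h
  have h2 := congrArg Complex.im h
  simp at h1 h2
  exact ⟨h1, h2⟩

/-- `ad ξ` acts on `ker η` through `𝔰𝔲(2)`. -/
theorem exists_lie_reeb (F : IsAdaptedFrame C e c) :
    ∃ p q r : ℝ, ⁅e 4, e 0⁆ = p • e 1 + q • e 2 + r • e 3 ∧
      ⁅e 4, e 1⁆ = -p • e 0 - r • e 2 + q • e 3 ∧
      ⁅e 4, e 2⁆ = -q • e 0 + r • e 1 - p • e 3 ∧
      ⁅e 4, e 3⁆ = -r • e 0 - q • e 1 + p • e 2 := by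
  have hη : ∀ X, C.η ⁅e 4, X⁆ = 0 := fun X => by rw [F.reeb, C.eta_lie_reeb]
  have hJ : ∀ X, ⁅e 4, C.J X⁆ = C.J ⁅e 4, X⁆ := fun X => by rw [F.reeb, C.lie_reeb_J]
  obtain ⟨p0, p1, p2, p3, h0⟩ := F.exists_coords ⁅e 4, e 0⁆
  obtain ⟨q0, q1, q2, q3, h2⟩ := F.exists_coords ⁅e 4, e 2⁆
  rw [hη, zero_smul, add_zero] at h0 h2
  have h1 : ⁅e 4, e 1⁆ = p0 • e 1 - p1 • e 0 + p2 • e 3 - p3 • e 2 := by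
    rw [← F.J0, hJ, h0]
    simp only [map_add, map_smul, F.J0, F.J1, F.J2, F.J3, smul_neg, ← sub_eq_add_neg]
  have h3 : ⁅e 4, e 3⁆ = q0 • e 1 - q1 • e 0 + q2 • e 3 - q3 • e 2 := by
    rw [← F.J2, hJ, h2]
    simp only [map_add, map_smul, F.J0, F.J1, F.J2, F.J3, smul_neg, ← sub_eq_add_neg]
  -- Invariance of `dη` under `ad ξ`; together with `J`-linearity it puts `ad ξ` in 𝔲(2).
  have skew : ∀ X Y : g, C.η ⁅⁅e 4, X⁆, Y⁆ - C.η ⁅⁅e 4, Y⁆, X⁆ = 0 := fun X Y => by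
    have := hη ⁅X, Y⁆
    rw [leibniz_lie, map_add, ← lie_skew X, map_neg] at this
    linarith
  have s01 := skew (e 0) (e 1)
  have s02 := skew (e 0) (e 2)
  have s03 := skew (e 0) (e 3)
  have s23 := skew (e 2) (e 3)
  have he := C.basic_d (e 0) (e 2)
  have sw : ∀ i j, C.η ⁅e i, e j⁆ = -C.η ⁅e j, e i⁆ := fun i j => by rw [← lie_skew, map_neg]
  rw [← F.reeb, d₂, C.eps_swap _ (e 4), F.eps_reeb_left] at he
  simp only [h0, h1, h2, h3, add_lie, sub_lie, smul_lie, map_add, map_sub, map_smul, lie_self,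
    map_zero, sw 1 0, sw 2 0, sw 3 0, sw 2 1, sw 3 1, sw 3 2, F.eta01, F.eta02, F.eta03, F.eta12,
    F.eta13, F.eta23, smul_eq_mul, LinearMap.add_apply, LinearMap.smul_apply, C.alternating,
    F.eps02, F.eps12, F.eps01, F.eps23, C.eps_swap (e 1) (e 0), C.eps_swap (e 2) (e 0),
    C.eps_swap (e 3) (e 0), C.eps_swap (e 3) (e 2), F.eps03] at s01 s02 s03 s23 he
  -- Invariance of `ε` says that the complex trace of `ad ξ` on `ker η` vanishes, which cuts 𝔲(2)
  -- down to 𝔰𝔲(2).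
  obtain ⟨k1, k2⟩ := F.eq_zero_of_mul_eq_zero (p := p0 + q2) (q := p1 + q3) (by
    simp only [Complex.real_smul] at he
    push_cast
    linear_combination -he)
  obtain rfl : p0 = 0 := by linarith
  obtain rfl : q2 = 0 := by linarith
  obtain rfl : q3 = -p1 := by linarith
  obtain rfl : q1 = p3 := by linarith
  obtain rfl : q0 = -p2 := by linarith
  refine ⟨p1, p2, q1, ?_, ?_, ?_, ?_⟩
  · rw [h0]; module
  · rw [h1]; module
  · rw [h2]; module
  · rw [h3]; module

/-- If `ad ξ ≠ 0`, then `ad ξ` is onto `ker η`, and the Lie algebra is perfect. -/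
theorem lie_reeb_eq_zero (F : IsAdaptedFrame C e c)
    (hg : (⁅(⊤ : LieIdeal ℝ g), (⊤ : LieIdeal ℝ g)⁆ : LieIdeal ℝ g) ≠ ⊤) (X : g) :
    ⁅e 4, X⁆ = 0 := by
  obtain ⟨p, q, r, h0, h1, h2, h3⟩ := F.exists_lie_reeb
  by_cases hn : p ^ 2 + q ^ 2 + r ^ 2 = 0
  · obtain rfl : p = 0 := by nlinarith [sq_nonneg p, sq_nonneg q, sq_nonneg r]
    obtain rfl : q = 0 := by nlinarith [sq_nonneg q, sq_nonneg r]
    obtain rfl : r = 0 := by nlinarith [sq_nonneg r]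
    obtain ⟨x, y, z, w, h⟩ := F.exists_coords X
    rw [h]
    simp [h0, h1, h2, h3]
  · exfalso
    apply hg
    set K := (⁅(⊤ : LieIdeal ℝ g), (⊤ : LieIdeal ℝ g)⁆ : LieIdeal ℝ g) with hK
    -- An imaginary quaternion squares to minus its squared norm, so `(ad ξ)²` is a nonzero scalar
    -- on `ker η`.
    have mem : ∀ i, ⁅e 4, ⁅e 4, e i⁆⁆ = -(p ^ 2 + q ^ 2 + r ^ 2) • e i → e i ∈ K := by
      intro i hi
      have := K.smul_mem (-(p ^ 2 + q ^ 2 + r ^ 2))⁻¹ (hi ▸ mem_derived (e 4) ⁅e 4, e i⁆)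
      rwa [smul_smul, inv_mul_cancel₀ (neg_ne_zero.2 hn), one_smul] at this
    have m0 : e 0 ∈ K := mem 0 (by
      rw [h0]; simp only [lie_add, lie_smul, h1, h2, h3]; module)
    have m1 : e 1 ∈ K := mem 1 (by
      rw [h1]; simp only [lie_add, lie_sub, lie_smul, h0, h2, h3]; module)
    have m2 : e 2 ∈ K := mem 2 (by
      rw [h2]; simp only [lie_add, lie_sub, lie_smul, h0, h1, h3]; module)
    have m3 : e 3 ∈ K := mem 3 (by
      rw [h3]; simp only [lie_add, lie_sub, lie_smul, h0, h1, h2]; module)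
    have comb : ∀ x y z w : ℝ, x • e 0 + y • e 1 + z • e 2 + w • e 3 ∈ K := fun x y z w =>
      add_mem (add_mem (add_mem (K.smul_mem _ m0) (K.smul_mem _ m1)) (K.smul_mem _ m2))
        (K.smul_mem _ m3)
    have m4 : e 4 ∈ K := by
      obtain ⟨x, y, z, w, h⟩ := F.exists_coords ⁅e 0, e 1⁆
      have m := sub_mem (mem_derived (e 0) (e 1)) (comb x y z w)
      have : e 4 = (-2⁻¹ : ℝ) • (⁅e 0, e 1⁆ - (x • e 0 + y • e 1 + z • e 2 + w • e 3)) := by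
        conv_rhs => rw [h, F.eta01]
        module
      rw [this]
      exact K.smul_mem _ m
    refine eq_top_iff.2 fun Y _ => ?_
    obtain ⟨x, y, z, w, h⟩ := F.exists_coords Y
    rw [h]
    exact add_mem (comb x y z w) (K.smul_mem _ m4)

end IsAdaptedFrame

end Central

end ContactCY

namespace ContactCY

/-! ### The transverse connection and its vanishing -/

section Flat

variable {g : Type*} [LieRing g] [LieAlgebra ℝ g]

namespace IsAdaptedFrame

variable {C : ContactCalabiYau g} {e : Module.Basis (Fin 5) ℝ g} {c : ℂ}

/-- When `ξ` is central, the brackets on `ker η` are, modulo `ξ`, of the form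
`[X, Y] = θ(X) Y - θ(Y) X` for a linear map `θ : ker η → 𝔰𝔲(2)`, the transverse Levi-Civita
connection; `pᵢ, qᵢ, rᵢ` are the components of `θ(eᵢ)`. -/
theorem exists_connection (F : IsAdaptedFrame C e c) (hc : ∀ X : g, ⁅e 4, X⁆ = 0) :
    ∃ p q r : Fin 4 → ℝ,
      ⁅e 0, e 1⁆ = (-p 0) • e 0 + (-p 1) • e 1 + (-r 0 - q 1) • e 2 + (q 0 - r 1) • e 3
        + (-2 : ℝ) • e 4 ∧
      ⁅e 0, e 2⁆ = (-q 0) • e 0 + (r 0 - p 2) • e 1 + (-q 2) • e 2 + (-p 0 - r 2) • e 3 ∧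
      ⁅e 0, e 3⁆ = (-r 0) • e 0 + (-q 0 - p 3) • e 1 + (p 0 - q 3) • e 2 + (-r 3) • e 3 ∧
      ⁅e 1, e 2⁆ = (-q 1 + p 2) • e 0 + (r 1) • e 1 + (r 2) • e 2 + (-p 1 - q 2) • e 3 ∧
      ⁅e 1, e 3⁆ = (-r 1 + p 3) • e 0 + (-q 1) • e 1 + (p 1 + r 3) • e 2 + (-q 3) • e 3 ∧
      ⁅e 2, e 3⁆ = (-r 2 + q 3) • e 0 + (-q 2 - r 3) • e 1 + (p 2) • e 2 + (p 3) • e 3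
        + (-2 : ℝ) • e 4 := by
  obtain ⟨a0, a1, a2, a3, h01⟩ := F.exists_coords ⁅e 0, e 1⁆
  obtain ⟨b0, b1, b2, b3, h02⟩ := F.exists_coords ⁅e 0, e 2⁆
  obtain ⟨c0, c1, c2, c3, h03⟩ := F.exists_coords ⁅e 0, e 3⁆
  obtain ⟨d0, d1, d2, d3, h12⟩ := F.exists_coords ⁅e 1, e 2⁆
  obtain ⟨f0, f1, f2, f3, h13⟩ := F.exists_coords ⁅e 1, e 3⁆
  obtain ⟨k0, k1, k2, k3, h23⟩ := F.exists_coords ⁅e 2, e 3⁆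
  simp only [F.eta01, F.eta02, F.eta03, F.eta12, F.eta13, F.eta23, zero_smul, add_zero]
    at h01 h02 h03 h12 h13 h23
  -- This is `d(dη) = 0`. It gives four real equations on the structure constants, and `dε = 0`
  -- gives four complex ones.
  have jac : ∀ X Y Z : g, C.η ⁅⁅X, Y⁆, Z⁆ - C.η ⁅⁅X, Z⁆, Y⁆ + C.η ⁅⁅Y, Z⁆, X⁆ = 0 := by
    intro X Y Z
    have h := congrArg C.η (leibniz_lie X Y Z)
    rw [map_add, ← lie_skew Y ⁅X, Z⁆, map_neg, ← lie_skew X, map_neg] at h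
    linarith
  have w10 := (lie_skew (e 1) (e 0)).symm
  have w20 := (lie_skew (e 2) (e 0)).symm
  have w30 := (lie_skew (e 3) (e 0)).symm
  have w21 := (lie_skew (e 2) (e 1)).symm
  have w31 := (lie_skew (e 3) (e 1)).symm
  have w32 := (lie_skew (e 3) (e 2)).symm
  have j012 := jac (e 0) (e 1) (e 2)
  have j013 := jac (e 0) (e 1) (e 3)
  have j023 := jac (e 0) (e 2) (e 3)
  have j123 := jac (e 1) (e 2) (e 3)
  have c012 := C.closed (e 0) (e 1) (e 2)
  have c013 := C.closed (e 0) (e 1) (e 3)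
  have c023 := C.closed (e 0) (e 2) (e 3)
  have c123 := C.closed (e 1) (e 2) (e 3)
  simp only [d₂, h01, h02, h03, h12, h13, h23, add_lie, smul_lie, map_add, map_smul, lie_self,
    map_zero, map_neg, hc, F.eta0, F.eta1, F.eta2, F.eta3, F.eta4, w10, w20, w30, w21, w31, w32,
    smul_eq_mul, LinearMap.add_apply, LinearMap.smul_apply, C.alternating, F.eps_reeb_left, F.eps01, F.eps02, F.eps03, F.eps12, F.eps13, F.eps23,
    C.eps_swap (e 1) (e 0), C.eps_swap (e 2) (e 0), C.eps_swap (e 3) (e 0),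
    C.eps_swap (e 2) (e 1), C.eps_swap (e 3) (e 1), C.eps_swap (e 3) (e 2), Complex.real_smul,
    neg_zero, mul_zero, add_zero, zero_add] at j012 j013 j023 j123 c012 c013 c023 c123
  obtain ⟨u012, v012⟩ := F.eq_zero_of_mul_eq_zero (p := -a0 + b3 + d2) (q := -a1 - b2 + d3) (by
    push_cast
    linear_combination c012)
  obtain ⟨u013, v013⟩ := F.eq_zero_of_mul_eq_zero (p := a1 + c3 + f2) (q := -a0 - c2 + f3) (by
    push_cast
    linear_combination c013)
  obtain ⟨u023, v023⟩ := F.eq_zero_of_mul_eq_zero (p := b1 + c0 + k2) (q := -b0 + c1 + k3) (by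
    push_cast
    linear_combination c023)
  obtain ⟨u123, v123⟩ := F.eq_zero_of_mul_eq_zero (p := d1 + f0 - k3) (q := -d0 + f1 + k2) (by
    push_cast
    linear_combination c123)
  -- Koszul's formula: `pᵢ, qᵢ, rᵢ` are the components of `∇_{eᵢ} e₀` along `e₁, e₂, e₃`.
  refine ⟨![-a0, -a1, (-b1 - a2 + d0) / 2, (-c1 - a3 + f0) / 2],
    ![-b0, (-a2 - b1 - d0) / 2, -b2, (-c2 - b3 + k0) / 2],
    ![-c0, (-a3 - c1 - f0) / 2, (-b3 - c2 - k0) / 2, -c3], ?_, ?_, ?_, ?_, ?_, ?_⟩ <;>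
  simp only [h01, h02, h03, h12, h13, h23, Matrix.cons_val] <;>
  match_scalars <;> linarith

/-- Vanishing of the transverse scalar curvature forces the connection to be zero. -/
theorem lie_eq (F : IsAdaptedFrame C e c) (hc : ∀ X : g, ⁅e 4, X⁆ = 0) :
    ⁅e 0, e 1⁆ = (-2 : ℝ) • e 4 ∧ ⁅e 0, e 2⁆ = 0 ∧ ⁅e 0, e 3⁆ = 0 ∧ ⁅e 1, e 2⁆ = 0 ∧
      ⁅e 1, e 3⁆ = 0 ∧ ⁅e 2, e 3⁆ = (-2 : ℝ) • e 4 := by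
  obtain ⟨p, q, r, h01, h02, h03, h12, h13, h23⟩ := F.exists_connection hc
  have sw : ∀ i j, ⁅e i, e j⁆ = -⁅e j, e i⁆ := fun i j => (lie_skew _ _).symm
  have hc' : ∀ X : g, ⁅X, e 4⁆ = 0 := fun X => by rw [← lie_skew, hc, neg_zero]
  have jac : ∀ i j k l, e.coord l ⁅e i, ⁅e j, e k⁆⁆ =
      e.coord l ⁅⁅e i, e j⁆, e k⁆ + e.coord l ⁅e j, ⁅e i, e k⁆⁆ := by
    intro i j k l
    rw [leibniz_lie, map_add]
  -- The alternating sum of these components contracts the Jacobi identity (first Bianchi) with the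
  -- volume form. For an 𝔰𝔲(2)-valued connection this is the scalar curvature up to a factor, and
  -- here it equals twice the sum of squares.
  have k0 := jac 1 2 3 0
  have k1 := jac 0 2 3 1
  have k2 := jac 0 1 3 2
  have k3 := jac 0 1 2 3
  simp only [h01, h02, h03, h12, h13, h23, sw 1 0, sw 2 0, sw 2 1, sw 3 2,
    lie_add, add_lie, lie_smul, smul_lie, lie_self, hc, hc', map_add, map_smul, map_neg, map_zero,
    Module.Basis.coord_apply, Module.Basis.repr_self, Finsupp.single_apply, smul_eq_mul,
    Fin.reduceEq, if_true, if_false] at k0 k1 k2 k3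
  have key : ∑ i, (p i ^ 2 + q i ^ 2 + r i ^ 2) = 0 := by
    rw [Fin.sum_univ_four]
    linear_combination (k0 - k1 + k2 - k3) / 2
  have hp : ∀ i, p i = 0 ∧ q i = 0 ∧ r i = 0 := by
    intro i
    have h := (Finset.sum_eq_zero_iff_of_nonneg fun i _ => by positivity).1 key i
      (Finset.mem_univ i)
    refine ⟨?_, ?_, ?_⟩ <;> rw [← sq_eq_zero_iff] <;>
      linarith [sq_nonneg (p i), sq_nonneg (q i), sq_nonneg (r i)]
  simp [h01, h02, h03, h12, h13, h23, hp]

end IsAdaptedFrame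

end Flat

end ContactCY

/-! ### Identification with 𝔥₁ -/

namespace ContactCY

theorem H1.isNilpotent : LieRing.IsNilpotent H1 := by
  have : Module.Finite ℝ H1 := inferInstanceAs (Module.Finite ℝ (Fin 5 → ℝ))
  -- Engel's theorem; `(ad x)² = 0` because every bracket is a multiple of the central `X₅`.
  rw [LieAlgebra.isNilpotent_iff_forall (R := ℝ)]
  intro x
  refine ⟨2, LinearMap.ext fun y => ?_⟩
  rw [pow_two, Module.End.mul_apply, LieAlgebra.ad_apply, LieAlgebra.ad_apply]
  funext k
  simp [H1.bracket_apply, H1.zero_apply]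

section Isomorphism

variable {g : Type*} [LieRing g] [LieAlgebra ℝ g]

/-- A Lie algebra with a basis whose brackets are those of `𝔥₁`. -/
noncomputable def H1.lieEquivOfBasis (e : Module.Basis (Fin 5) ℝ g) (hc : ∀ X : g, ⁅e 4, X⁆ = 0)
    (h01 : ⁅e 0, e 1⁆ = (-2 : ℝ) • e 4) (h02 : ⁅e 0, e 2⁆ = 0) (h03 : ⁅e 0, e 3⁆ = 0)
    (h12 : ⁅e 1, e 2⁆ = 0) (h13 : ⁅e 1, e 3⁆ = 0) (h23 : ⁅e 2, e 3⁆ = (-2 : ℝ) • e 4) :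
    H1 ≃ₗ⁅ℝ⁆ g where
  -- `X₁, X₄` go to `e 0, e 1`, `X₂, X₃` to `e 2, e 3`, and `X₅` to `-2 ξ`.
  toFun v := v 0 • e 0 + v 3 • e 1 + v 1 • e 2 + v 2 • e 3 + (-2 * v 4) • e 4
  map_add' v w := by simp only [H1.add_apply]; module
  map_smul' t v := by simp only [H1.smul_apply, RingHom.id_apply]; module
  map_lie' {v w} := by
    have hc' : ∀ X : g, ⁅X, e 4⁆ = 0 := fun X => by rw [← lie_skew, hc, neg_zero]
    have sw : ∀ i j, ⁅e i, e j⁆ = -⁅e j, e i⁆ := fun i j => (lie_skew _ _).symm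
    simp only [H1.bracket_apply, lie_add, add_lie, lie_smul, smul_lie, lie_self, hc, hc', h01,
      h02, h03, h12, h13, h23, sw 1 0, sw 2 0, sw 3 0, sw 2 1, sw 3 1, sw 3 2, Fin.reduceEq,
      if_true, if_false]
    module
  invFun X := fun k : Fin 5 => ![e.repr X 0, e.repr X 2, e.repr X 3, e.repr X 1, -e.repr X 4 / 2] k
  left_inv v := by
    funext k
    fin_cases k <;> simp
  right_inv X := by
    conv_rhs => rw [← e.sum_repr X, Fin.sum_univ_five]
    simp only [Matrix.cons_val]
    module

theorem ContactCalabiYau.nonempty_lieEquiv_H1 (hdim : Module.finrank ℝ g = 5)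
    (hg : (⁅(⊤ : LieIdeal ℝ g), (⊤ : LieIdeal ℝ g)⁆ : LieIdeal ℝ g) ≠ ⊤)
    (C : ContactCalabiYau g) : Nonempty (g ≃ₗ⁅ℝ⁆ H1) := by
  obtain ⟨e, c, F⟩ := C.exists_adaptedFrame hdim
  have hc := F.lie_reeb_eq_zero hg
  obtain ⟨h01, h02, h03, h12, h13, h23⟩ := F.lie_eq hc
  exact ⟨(H1.lieEquivOfBasis e hc h01 h02 h03 h12 h13 h23).symm⟩

end Isomorphism

end ContactCY

theorem proposition4p4 (g : Type*) [LieRing g] [LieAlgebra ℝ g]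
    (hdim : Module.finrank ℝ g = 5) :
    LieRing.IsNilpotent ContactCY.H1 ∧
    ((⁅(⊤ : LieIdeal ℝ g), (⊤ : LieIdeal ℝ g)⁆ : LieIdeal ℝ g) ≠ ⊤ →
      Nonempty (ContactCY.ContactCalabiYau g) →
      Nonempty (g ≃ₗ⁅ℝ⁆ ContactCY.H1)) ∧
    (LieAlgebra.IsSolvable g → ¬ LieRing.IsNilpotent g →
      ¬ Nonempty (ContactCY.ContactCalabiYau g)) := by
  refine ⟨ContactCY.H1.isNilpotent, fun hg ⟨C⟩ => C.nonempty_lieEquiv_H1 hdim hg, ?_⟩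
  rintro hsolv hnil ⟨C⟩
  have : Nontrivial g := Module.nontrivial_of_finrank_pos (R := ℝ) (by omega)
  -- A nonzero solvable Lie algebra is not perfect, so the first case applies.
  obtain ⟨f⟩ := C.nonempty_lieEquiv_H1 hdim
    (LieAlgebra.derivedSeries_lt_top_of_solvable (R := ℝ) (L := g)).ne
  exact hnil (f.nilpotent_iff_equiv_nilpotent.2 ContactCY.H1.isNilpotent)
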